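/- Time is discrete, clocks are synchronized, and the network is partially synchronous: the adversary chooses a global stabilization time GST, after which messages are delivered within a known delay $\Delta$. A ledger is a finite sequence of time-stamped blocks of transactions; two ledgers are consistent if one is a prefix of the other. For a blockchain protocol $\Pi$: * $\Pi$ is **safe** if in every execution the ledgers $L^c_t$ and $L^{c'}_{t'}$ output by any clients $c,c'$ at any times $t,t'$ are consistent, and $L^c_t$ is a prefix of $L^c_{t'}$ for $t\le t'$. * $\Pi$ is **live with latency $\tau$** if in every execution each transaction that is input to all honest validators at time $t$ is in $L^c_{t'}$ for every client $c$ and every $t'\ge\max(\mathrm{GST},t)+\tau$, and clients keep outputting blocks: for $t'\ge \mathrm{GST}+\tau$, $L^c_{t'}$ contains a block with time stamp at least $t'-\tau$. * $\Pi$ **generates certificates** if, in every execution that meets its conditions for safety, there are no two conflicting ledgers $L_1,L_2$ and sets $M_1,M_2$ of broadcast consensus messages such that $L_i$ is a prefix of the ledger that the confirmation rule determines on $M_i$. * $\Pi$ **proceeds in epochs of fixed duration $T>0$** if, in every execution in which it is live (with some latency), every ledger that a client outputs at a time $t$ consists of blocks with time stamps at most $t$, successive ones at least $T$ apart (so that blocks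 are confirmed at a rate of at most one per $T$). An overlay protocol on $n$ underlay chains consists of a deterministic smart contract for each chain, which sends cross-chain messages as a function of the finalized ledger of its chain, and a rule by which a client computes the overlay ledger from the time and its current ledgers of the $n$ underlay chains. The honest validators of each chain submit to their chain, as transactions, the messages that they see on the finalized ledgers of the other chains, and the finality of the messages included in a ledger is verified: they come from ledgers output by clients of (or, for ledgers that are merely certified, from ledgers certified on) the source chain. A live chain has at least one honest validator. A transaction is input to the overlay protocol when it is input to the honest validators of all underlay chains; the consensus messages of the overlay protocol are those of the underlay chains, and its conditions for safety are that the conditions of all underlay chains hold. **Lemma.** Let $f\ge1$, and let $\Delta$ and $\tau$ be given. There are an overlay protocol on $2f+1$ underlay chains (a $(2f+1)$-triangular composition), a duration $T>0$ and a latency $\tau'$ such that for all blockchain protocols $\Pi_1,\dots,\Pi_{2f+1}$, each of which proceeds in epochs of some fixed duration, the overlay protocol run on $\Pi_1,\dots,\Pi_{2f+1}$ has the following properties: 1. it is safe if all $\Pi_i$ are safe; 2. it is live with latency $\tau'$ if at least $f+1$ of the $\Pi_i$ are live with latency $\tau$; 3. it generates certificates if all $\Pi_i$ generate certificates; 4.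 it proceeds in epochs of fixed duration $T$. -/

import Mathlib

/-! Blockchain protocols under partial synchrony, and protocols run on top of them.

Time is discrete and clocks are synchronized. `X` is a type of transactions. -/

namespace Interchain

/-- A block: the start of the epoch (slot) in which it was made, and its transactions. The parent
pointers of blocks are represented by their order in a ledger. -/
structure Block (X : Type) where
  time : ℕ
  txs : List X

/-- A ledger: a chain of blocks, oldest first; the chain of the genesis block alone is `[]`. -/
abbrev Ledger (X : Type) : Type := List (Block X)

/-- The transaction `x` occurs in the ledger `L`. -/
def Contains {X : Type} (L : Ledger X) (x : X) : Prop := ∃ b ∈ L, x ∈ b.txs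

/-- One of the two ledgers extends the other. -/
def Consistent {X : Type} (L L' : Ledger X) : Prop := L <+: L' ∨ L' <+: L

/-- What an execution of a blockchain protocol shows to the outside. The adversary chooses `gst`
and, subject to the protocol, everything else. -/
structure Execution (Client X Msg : Type) where
  /-- the global stabilization time -/
  gst : ℕ
  /-- the transactions that are input to all honest validators at a given time -/
  input : ℕ → Set X
  /-- the consensus messages that have been broadcast by a given time -/
  bcast : ℕ → Set Msg
  /-- the consensus messages that a client holds at a given time -/
  recv : Client → ℕ → Set Msg
  bcast_mono : Monotone bcast
  recv_subset : ∀ c t, recv c t ⊆ bcast t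

/-- A blockchain protocol: its consensus messages, the confirmation rule by which a client obtains
its ledger at time `t` from the messages it holds (it may use its clock), the executions that are
possible under the adversaries considered, and those that meet the conditions under which
the protocol is claimed to be safe (such as: over two thirds of the validators are honest).

The set of executions is arbitrary. It can be a single execution, so that whatever is proved for
all protocols also holds execution by execution. -/
structure Protocol (Client X : Type) where
  Msg : Type
  confirm : ℕ → Set Msg → Ledger X
  executions : Set (Execution Client X Msg)
  safeCondition : Set (Execution Client X Msg)

namespace Protocol

variable {Client X : Type}

/-- The ledger that client `c` outputs at time `t`. -/
def ledger (P : Protocol Client X) (e : Execution Client X P.Msg) (c : Client) (t : ℕ) :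
    Ledger X :=
  P.confirm t (e.recv c t)

/-- Safety in an execution: the ledgers of all clients at all times are consistent, and the ledger
of a client is only ever extended. -/
def SafeIn (P : Protocol Client X) (e : Execution Client X P.Msg) : Prop :=
  (∀ c c' t t', Consistent (P.ledger e c t) (P.ledger e c' t')) ∧
  ∀ c t t', t ≤ t' → P.ledger e c t <+: P.ledger e c t'

/-- Liveness after GST with latency `τ` in an execution: every transaction that is input to all
honest validators at time `t` is in the ledger of every client from time `max GST t + τ` on, and
clients keep outputting blocks: from time `GST + τ` on, the ledger of every client contains a
block that is at most `τ` old. -/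
def LiveIn (P : Protocol Client X) (e : Execution Client X P.Msg) (τ : ℕ) : Prop :=
  (∀ t, ∀ x ∈ e.input t, ∀ c t', max e.gst t + τ ≤ t' → Contains (P.ledger e c t') x) ∧
  ∀ c t', e.gst + τ ≤ t' → ∃ b ∈ P.ledger e c t', t' ≤ b.time + τ

/-- There are no conflicting ledgers that are prefixes of ledgers confirmed by sets of messages
which have been broadcast. -/
def NoConflictingCertificates (P : Protocol Client X) (e : Execution Client X P.Msg) : Prop :=
  ∀ t₁ t₂ M₁ M₂, M₁ ⊆ e.bcast t₁ → M₂ ⊆ e.bcast t₂ →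
    ∀ L₁ L₂, L₁ <+: P.confirm t₁ M₁ → L₂ <+: P.confirm t₂ M₂ → Consistent L₁ L₂

/-- No block is confirmed before its time, and successive blocks of a ledger are at least `T`
apart. Hence a ledger output at time `t` has at most `t / T + 1` blocks. -/
def EpochsIn (P : Protocol Client X) (e : Execution Client X P.Msg) (T : ℕ) : Prop :=
  ∀ c t, (∀ b ∈ P.ledger e c t, b.time ≤ t) ∧
    (P.ledger e c t).Pairwise fun b b' => b.time + T ≤ b'.time

/-- The protocol is safe. -/
def Safe (P : Protocol Client X) : Prop := ∀ e ∈ P.executions, P.SafeIn e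

/-- The protocol is live after GST with constant latency `τ`. -/
def Live (P : Protocol Client X) (τ : ℕ) : Prop := ∀ e ∈ P.executions, P.LiveIn e τ

/-- The protocol generates certificates: under its conditions for safety, there are no
certificates for conflicting ledgers. -/
def GeneratesCertificates (P : Protocol Client X) : Prop :=
  ∀ e ∈ P.executions, e ∈ P.safeCondition → P.NoConflictingCertificates e

/-- The protocol proceeds in epochs of fixed duration `T`: whenever it is live, blocks are
confirmed at a rate of at most one per `T`, and they carry their time. -/
def ProceedsInEpochs (P : Protocol Client X) (T : ℕ) : Prop :=
  ∀ e ∈ P.executions, (∃ τ, P.LiveIn e τ) → P.EpochsIn e T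

end Protocol

/-- A transaction on an underlay chain of an overlay protocol with `n` underlay chains: a
transaction of the overlay protocol, or a cross-chain message `m` from the chain `src`. -/
inductive Item (n : ℕ) (X Pkt : Type) where
  | user (x : X)
  | packet (src : Fin n) (m : Pkt)

/-- The code of an overlay (interchain consensus) protocol on `n` underlay chains: the type of
cross-chain messages, the smart contract on each chain, given by the messages that it has sent
according to a finalized ledger of the chain, and the rule by which a client obtains the overlay
ledger at time `t` from its current ledgers of the underlay chains. -/
structure Overlay (n : ℕ) (X : Type) where
  Pkt : Type
  emit : Fin n → Ledger (Item n X Pkt) → List Pkt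
  read : ℕ → (Fin n → Ledger (Item n X Pkt)) → Ledger X

namespace Overlay

variable {n : ℕ} {X Client : Type}

/-- An execution of the overlay protocol `C` on the underlay protocols `P`, where messages are
delivered within `Δ` after GST. All participants observe all chains; the chains interact through
cross-chain communication only. -/
structure Run (C : Overlay n X) (Δ : ℕ) (P : Fin n → Protocol Client (Item n X C.Pkt)) where
  /-- the execution of each underlay chain -/
  exec : ∀ i, Execution Client (Item n X C.Pkt) (P i).Msg
  exec_mem : ∀ i, exec i ∈ (P i).executions
  /-- the common global stabilization time -/
  gst : ℕ
  gst_eq : ∀ i, (exec i).gst = gst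
  /-- the honest validators of each chain, who are clients of the other chains -/
  honest : Fin n → Set Client
  honest_nonempty : ∀ i, (∃ τ, (P i).LiveIn (exec i) τ) → (honest i).Nonempty
  /-- An honest validator of chain `i` that sees a message sent by chain `j` broadcasts it to the
  validators of chain `i` as a transaction. -/
  relay : ∀ i j, i ≠ j → ∀ p ∈ honest i, ∀ t, ∀ m ∈ C.emit j ((P j).ledger (exec j) p t),
    ∃ t', t ≤ t' ∧ t' ≤ max gst t + Δ ∧ Item.packet j m ∈ (exec i).input t'
  /-- The finality of cross-chain messages is verified: in a ledger output by a client, each comes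
  from a ledger that a client of the source chain has output. -/
  authentic : ∀ i j m c t, Contains ((P i).ledger (exec i) c t) (Item.packet j m) →
    ∃ c' t', t' ≤ t ∧ m ∈ C.emit j ((P j).ledger (exec j) c' t')
  /-- The same for certified ledgers, whether or not a client has output them. -/
  authentic_certified : ∀ i j m t M, M ⊆ (exec i).bcast t →
    Contains ((P i).confirm t M) (Item.packet j m) →
    ∃ t' M', t' ≤ t ∧ M' ⊆ (exec j).bcast t' ∧ m ∈ C.emit j ((P j).confirm t' M')

/-- A run seen as an execution of one blockchain protocol. The honest validators of the overlay
are those of all the underlay chains, so a transaction is input to them all when it is input to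
the honest validators of every underlay chain. -/
def Run.toExecution {C : Overlay n X} {Δ : ℕ} {P : Fin n → Protocol Client (Item n X C.Pkt)}
    (r : C.Run Δ P) : Execution Client X (Σ i, (P i).Msg) where
  gst := r.gst
  input t := {x | ∀ i, Item.user x ∈ (r.exec i).input t}
  bcast t := {m | m.2 ∈ (r.exec m.1).bcast t}
  recv c t := {m | m.2 ∈ (r.exec m.1).recv c t}
  bcast_mono := fun _ _ h m hm => (r.exec m.1).bcast_mono h hm
  recv_subset := fun c t m hm => (r.exec m.1).recv_subset c t hm

/-- The blockchain protocol obtained by running the overlay protocol `C` on the underlay protocols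
`P`. Its messages are those of the underlay chains; its conditions for safety are that the
conditions of all underlay chains hold. -/
def on (C : Overlay n X) (Δ : ℕ) (P : Fin n → Protocol Client (Item n X C.Pkt)) :
    Protocol Client X where
  Msg := Σ i, (P i).Msg
  confirm t M := C.read t fun i => (P i).confirm t {m | (⟨i, m⟩ : Σ i, (P i).Msg) ∈ M}
  executions := {e | ∃ r : C.Run Δ P, e = r.toExecution}
  safeCondition := {e | ∃ r : C.Run Δ P, e = r.toExecution ∧ ∀ i, r.exec i ∈ (P i).safeCondition}

end Overlay

end Interchain

open Interchain

/-! An overlay protocol that runs a crash-tolerant, view-based consensus protocol with the chains as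
replicas. View `v` is the span of times from `v * D` to `(v + 1) * D`, and its leader is the chain
`v % (2 * f + 1)`. -/

namespace Interchain

/-! The argument is Paxos with chains as replicas and no Byzantine voting. A leader proposes only
once a majority has entered its view, and extends the proposal of the latest view that it has heard
of. A deciding majority for `u` meets the majority behind any proposal for a later view in a chain
`k`. The snapshot of `k` extends its ledger before the end of `u`, so it carries the decided
proposal; by induction on views all later proposals extend it (`Coherent.mem_received`,
`Coherent.prefix_of_mem_proposals`).

All of this uses only `Coherent`: ledgers of one chain are consistent, and packets are what the
contracts really send. Ledgers output by clients of safe chains form a coherent family, as do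
ledgers certified by broadcast messages; this gives safety and certificates.

Liveness must hold even if chains, live ones included, are unsafe. If the client's ledgers lie in no
coherent family, some chain has failed and the client may output everything. Otherwise snapshots
received by live chains force the ledgers seen by their honest validators into the family, so the
Paxos argument applies to them, and a view with a live leader decides
(`LiveMajority.exists_decided`). -/

/-- A cross-chain message: a snapshot of the ledger of the sender, and the proposals for each view
that the sender has made or received according to that ledger. -/
inductive Pkt (n : ℕ) (X : Type) : Type where
  | mk (snap : List (Block (Item n X (Pkt n X)))) (know : ℕ → Set (Ledger X))

namespace Pkt

variable {n : ℕ} {X : Type}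

/-- The ledger of the sender. -/
def snap : Pkt n X → Ledger (Item n X (Pkt n X))
  | mk L _ => L

/-- The proposals for a view that are known to the sender. -/
def know : Pkt n X → ℕ → Set (Ledger X)
  | mk _ k => k

end Pkt

/-- Makes it possible to trace a relayed proposal back through nested snapshots by induction on
size. -/
theorem sizeOf_snap_lt {n : ℕ} {X : Type} {L : Ledger (Item n X (Pkt n X))} {j : Fin n}
    {m : Pkt n X} (h : Contains L (Item.packet j m)) : sizeOf m.snap < sizeOf L := by
  obtain ⟨b, hb, hm⟩ := h
  have h1 := List.sizeOf_lt_of_mem hb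
  have h2 := List.sizeOf_lt_of_mem hm
  cases m; cases b
  simp only [Pkt.snap, Item.packet.sizeOf_spec, Pkt.mk.sizeOf_spec, Block.mk.sizeOf_spec] at *
  omega

/-! ### Ledgers -/

section Ledgers

variable {X : Type}

theorem Contains.mono {L L' : Ledger X} {x : X} (h : Contains L x) (hL : L <+: L') :
    Contains L' x :=
  let ⟨b, hb, hx⟩ := h
  ⟨b, hL.subset hb, hx⟩

theorem Consistent.of_prefix {L₁ L₂ L₁' L₂' : Ledger X} (h : Consistent L₁ L₂)
    (h₁ : L₁' <+: L₁) (h₂ : L₂' <+: L₂) : Consistent L₁' L₂' := by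
  rcases h with h | h
  · exact List.prefix_or_prefix_of_prefix (h₁.trans h) h₂
  · exact List.prefix_or_prefix_of_prefix h₁ (h₂.trans h)

/-- The ledger `L` has reached the time `a`. -/
def Reached (a : ℕ) (L : Ledger X) : Prop := ∃ b ∈ L, a ≤ b.time

/-- The part of `L` before it first reaches the time `a`. -/
def upTo (a : ℕ) (L : Ledger X) : Ledger X := L.takeWhile fun b => b.time < a

theorem Reached.mono {a : ℕ} {L L' : Ledger X} (h : Reached a L) (hL : L <+: L') :
    Reached a L' :=
  let ⟨b, hb, hx⟩ := h
  ⟨b, hL.subset hb, hx⟩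

theorem upTo_prefix (a : ℕ) (L : Ledger X) : upTo a L <+: L := List.takeWhile_prefix _

theorem upTo_mono (a : ℕ) {L L' : Ledger X} (h : L <+: L') : upTo a L <+: upTo a L' := by
  obtain ⟨K, rfl⟩ := h
  simp only [upTo, List.takeWhile_append]
  split_ifs with h
  · rw [List.IsPrefix.eq_of_length (List.takeWhile_prefix _) h]
    exact List.prefix_append _ _
  · exact List.prefix_rfl

theorem upTo_eq_self {a : ℕ} {L : Ledger X} (h : ∀ b ∈ L, b.time < a) : upTo a L = L := by
  simpa [upTo, List.takeWhile_eq_self_iff] using h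

/-- A ledger that has reached a time extends the part before that time of any ledger that is
consistent with it. -/
theorem upTo_prefix_of_reached {a : ℕ} {L S : Ledger X} (h : Consistent L S) (hS : Reached a S) :
    upTo a L <+: S := by
  rcases h with h | h
  · exact (upTo_prefix a L).trans h
  · rcases List.prefix_or_prefix_of_prefix (upTo_prefix a L) h with h' | h'
    · exact h'
    -- Here `S` would lie within the part before `a`, so it could not have reached `a`.
    · obtain ⟨b, hb, hab⟩ := hS
      have := List.mem_takeWhile_imp (h'.subset hb)
      simp at this
      omega

/-- An element of the set at the greatest index below `v` where there is one. -/
noncomputable def latest (R : ℕ → Set (Ledger X)) : ℕ → Ledger X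
  | 0 => []
  | v + 1 => open Classical in if h : (R v).Nonempty then h.some else latest R v

theorem latest_spec (R : ℕ → Set (Ledger X)) (v : ℕ) :
    (latest R v = [] ∧ ∀ u < v, R u = ∅) ∨
      ∃ w < v, latest R v ∈ R w ∧ ∀ u, w < u → u < v → R u = ∅ := by
  induction v with
  | zero => exact .inl ⟨rfl, by simp⟩
  | succ v ih =>
    by_cases h : (R v).Nonempty
    · refine .inr ⟨v, by omega, ?_, fun u _ _ => by omega⟩
      rw [latest, dif_pos h]
      exact h.some_mem
    · have hv : latest R (v + 1) = latest R v := by rw [latest, dif_neg h]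
      have hv' : R v = ∅ := Set.not_nonempty_iff_eq_empty.1 h
      rw [hv]
      rcases ih with ⟨h1, h2⟩ | ⟨w, hw, h1, h2⟩
      · refine .inl ⟨h1, fun u hu => ?_⟩
        rcases Nat.lt_succ_iff_lt_or_eq.1 hu with hu | rfl
        exacts [h2 u hu, hv']
      · refine .inr ⟨w, by omega, h1, fun u hwu hu => ?_⟩
        rcases Nat.lt_succ_iff_lt_or_eq.1 hu with hu | rfl
        exacts [h2 u hwu hu, hv']

theorem exists_latest_mem {R : ℕ → Set (Ledger X)} {u v : ℕ} (h : (R u).Nonempty) (huv : u < v) :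
    ∃ w, u ≤ w ∧ w < v ∧ latest R v ∈ R w := by
  rcases latest_spec R v with ⟨_, h2⟩ | ⟨w, hw, h1, h2⟩
  · exact absurd (h2 u huv) h.ne_empty
  · refine ⟨w, ?_, hw, h1⟩
    by_contra! hwu
    exact h.ne_empty (h2 u hwu huv)

end Ledgers

/-- Two majorities intersect. -/
theorem exists_mem_of_majorities {f : ℕ} {A B : Set (Fin (2 * f + 1))} (hA : f + 1 ≤ A.ncard)
    (hB : f + 1 ≤ B.ncard) : ∃ k, k ∈ A ∧ k ∈ B := by
  by_contra! h
  have hd : Disjoint A B := Set.disjoint_left.2 h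
  have h1 := Set.ncard_union_eq hd
  have h2 := Set.ncard_le_card (A ∪ B)
  simp at h2
  omega

/-! ### The protocol -/

section Consensus

variable {f : ℕ} {X : Type}

/-- The ledgers of the underlay chains. -/
abbrev Chain (f : ℕ) (X : Type) : Type :=
  Ledger (Item (2 * f + 1) X (Pkt (2 * f + 1) X))

/-- The leader of a view. -/
def leader (f v : ℕ) : Fin (2 * f + 1) := Fin.ofNat (2 * f + 1) v

/-- The user transactions in a ledger. -/
def userTxs {n : ℕ} {Y : Type} (L : Ledger (Item n X Y)) : List X :=
  L.flatMap fun b => b.txs.filterMap fun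
    | .user x => some x
    | .packet _ _ => none

theorem mem_userTxs {n : ℕ} {Y : Type} {L : Ledger (Item n X Y)} {x : X} :
    x ∈ userTxs L ↔ Contains L (Item.user x) := by
  simp only [userTxs, List.mem_flatMap, List.mem_filterMap, Contains]
  refine exists_congr fun b => and_congr_right fun _ => ?_
  constructor
  · rintro ⟨y | y, hy, h⟩ <;> simp_all
  · exact fun h => ⟨_, h, rfl⟩

/-- The proposals for the view `w` that have been received according to the ledger `L`. -/
def received (L : Chain f X) (w : ℕ) : Set (Ledger X) :=
  {V | ∃ j m, Contains L (Item.packet j m) ∧ V ∈ m.know w}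

/-- According to its ledger `Q`, the chain `i` and `f` others have entered the view `v`. -/
def Ready (D : ℕ) (i : Fin (2 * f + 1)) (v : ℕ) (Q : Chain f X) : Prop :=
  Reached (v * D) Q ∧
    f + 1 ≤ {k | k = i ∨ ∃ m, Contains Q (Item.packet k m) ∧ Reached (v * D) m.snap}.ncard

/-- What the leader proposes in the view `v` according to its ledger `Q`. -/
noncomputable def extension (D v : ℕ) (Q : Chain f X) : Ledger X :=
  latest (received Q) v ++ [⟨v * D, userTxs Q⟩]

/-- The proposals of the chain `i` for the view `v`; there is at most one. -/
def proposals (D : ℕ) (i : Fin (2 * f + 1)) (L : Chain f X) (v : ℕ) : Set (Ledger X) :=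
  {V | leader f v = i ∧ ∃ Q, Q <+: L ∧ Ready D i v Q ∧ (∀ Q', Q' <+: Q → Ready D i v Q' → Q' = Q) ∧
    V = extension D v Q}

/-- The message sent by the chain `i` with ledger `L`. -/
def message (D : ℕ) (i : Fin (2 * f + 1)) (L : Chain f X) : Pkt (2 * f + 1) X :=
  .mk L fun w => received L w ∪ proposals D i L w

/-- The proposals for the view `v` that have been accepted by a majority of the chains, that is,
received before the end of the view. -/
def decided (D : ℕ) (W : Fin (2 * f + 1) → Chain f X) (v : ℕ) : Set (Ledger X) :=
  {V | f + 1 ≤ {i | V ∈ received (upTo ((v + 1) * D) (W i)) v}.ncard}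

/-- The ledgers `Λ i` are possible as ledgers of the chains `i` when all chains are safe. -/
def Coherent (D : ℕ) (Λ : Fin (2 * f + 1) → Set (Chain f X)) : Prop :=
  (∀ i, ∀ L ∈ Λ i, ∀ L' ∈ Λ i, Consistent L L') ∧
    ∀ i, ∀ L ∈ Λ i, ∀ j m, Contains L (Item.packet j m) → ∃ L' ∈ Λ j, m = message D j L'

/-- The current ledgers of the chains do not prove that some chain is not safe. -/
def Plausible (D : ℕ) (W : Fin (2 * f + 1) → Chain f X) : Prop :=
  ∃ Λ, Coherent D Λ ∧ ∀ i, W i ∈ Λ i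

/-- The consensus protocol as an overlay protocol. A client that can prove that some chain is not
safe outputs all transactions that it sees. -/
noncomputable def consensus (f D : ℕ) (X : Type) : Overlay (2 * f + 1) X where
  Pkt := Pkt (2 * f + 1) X
  emit i L := [message D i L]
  read t W := open Classical in
    if Plausible D W then latest (decided D W) (t / D + 1)
    else [⟨t, (List.finRange (2 * f + 1)).flatMap fun i => userTxs (W i)⟩]

/-! ### Safety -/

variable {D : ℕ} {Λ : Fin (2 * f + 1) → Set (Chain f X)}

theorem received_mono {L L' : Chain f X} (h : L <+: L') (w : ℕ) :
    received L w ⊆ received L' w := fun _ ⟨j, m, hm, hV⟩ => ⟨j, m, hm.mono h, hV⟩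

theorem decided_mono {W W' : Fin (2 * f + 1) → Chain f X} (h : ∀ i, W i <+: W' i) (v : ℕ) :
    decided D W v ⊆ decided D W' v := fun _ hV =>
  le_trans hV (Set.ncard_le_ncard (fun i hi => received_mono (upTo_mono _ (h i)) v hi)
    (Set.toFinite _))

/-- A proposal is a function of the shortest ready prefix, and consistent ledgers share that prefix.
-/
theorem proposals_eq {i : Fin (2 * f + 1)} {L L' : Chain f X} {v : ℕ} {V V' : Ledger X}
    (h : Consistent L L') (hV : V ∈ proposals D i L v) (hV' : V' ∈ proposals D i L' v) :
    V = V' := by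
  obtain ⟨_, Q, hQ, hr, hm, rfl⟩ := hV
  obtain ⟨_, Q', hQ', hr', hm', rfl⟩ := hV'
  rcases h.of_prefix hQ hQ' with h | h
  · rw [hm' Q h hr]
  · rw [hm Q' h hr']

theorem exists_proposal {v : ℕ} {L : Chain f X} (h : Ready D (leader f v) v L) :
    (proposals D (leader f v) L v).Nonempty := by
  induction hn : L.length using Nat.strong_induction_on generalizing L with
  | _ n ih =>
    by_cases hm : ∀ Q', Q' <+: L → Ready D (leader f v) v Q' → Q' = L
    · exact ⟨_, rfl, L, List.prefix_rfl, h, hm, rfl⟩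
    · push Not at hm
      obtain ⟨Q, hQ, hr, hne⟩ := hm
      have hlt : Q.length < L.length :=
        lt_of_le_of_ne hQ.length_le fun h => hne (hQ.eq_of_length h)
      obtain ⟨V, hl, Q', hQ', h'⟩ := ih _ (hn ▸ hlt) hr rfl
      exact ⟨V, hl, Q', hQ'.trans hQ, h'⟩

/-- A packet either relays a proposal, which is then in the strictly smaller snapshot of its sender,
or comes from the leader itself; descent ends at the leader. -/
theorem Coherent.exists_origin (hΛ : Coherent D Λ) {i : Fin (2 * f + 1)} {L : Chain f X}
    (hL : L ∈ Λ i) {w : ℕ} {V : Ledger X} (hV : V ∈ received L w) :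
    ∃ L' ∈ Λ (leader f w), V ∈ proposals D (leader f w) L' w := by
  induction hn : sizeOf L using Nat.strong_induction_on generalizing L i with
  | _ n ih =>
    obtain ⟨j, m, hm, hVm⟩ := hV
    obtain ⟨L', hL', rfl⟩ := hΛ.2 i L hL j m hm
    rcases hVm with hVm | hVm
    · exact ih _ (hn ▸ sizeOf_snap_lt hm) hL' hVm rfl
    · obtain rfl := hVm.1
      exact ⟨L', hL', hVm⟩

theorem Coherent.sorted (hΛ : Coherent D Λ) (hD : 0 < D) {w : ℕ} {L : Chain f X}
    (hL : L ∈ Λ (leader f w)) {V : Ledger X} (hV : V ∈ proposals D (leader f w) L w) :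
    (∀ b ∈ V, b.time ≤ w * D) ∧ V.Pairwise fun b b' => b.time + 1 ≤ b'.time := by
  induction w using Nat.strong_induction_on generalizing L V with
  | _ w ih =>
    obtain ⟨_, Q, hQ, -, -, rfl⟩ := hV
    have hB : (∀ b ∈ latest (received Q) w, b.time + 1 ≤ w * D) ∧
        (latest (received Q) w).Pairwise fun b b' => b.time + 1 ≤ b'.time := by
      rcases latest_spec (received Q) w with ⟨h, _⟩ | ⟨u, hu, h, _⟩
      · simp [h]
      · obtain ⟨L', hL', hV'⟩ := hΛ.exists_origin hL (received_mono hQ u h)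
        obtain ⟨h1, h2⟩ := ih u hu hL' hV'
        have : u * D < w * D := Nat.mul_lt_mul_of_pos_right hu hD
        exact ⟨fun b hb => by have := h1 b hb; omega, h2⟩
    refine ⟨fun b hb => ?_, ?_⟩
    · rcases List.mem_append.1 hb with hb | hb
      · have := hB.1 b hb; omega
      · simp at hb; simp [hb]
    · refine List.pairwise_append.2 ⟨hB.2, by simp, fun b hb b' hb' => ?_⟩
      simp at hb'
      simpa [hb'] using hB.1 b hb

/-- A chain that has entered a later view has received every proposal that it has accepted. -/
theorem Coherent.mem_received (hΛ : Coherent D Λ) {W : Fin (2 * f + 1) → Chain f X}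
    (hW : ∀ i, W i ∈ Λ i) {u v : ℕ} (huv : u < v) {V : Ledger X} (hV : V ∈ decided D W u)
    {i : Fin (2 * f + 1)} {L Q : Chain f X} (hL : L ∈ Λ i) (hQL : Q <+: L)
    (hQ : Ready D i v Q) : V ∈ received Q u := by
  -- The chain `k` accepted `V` in view `u`, and `Q` shows that it has entered view `v`.
  obtain ⟨k, hk1, hk2⟩ := exists_mem_of_majorities hV hQ.2
  have key : ∀ S L', L' ∈ Λ k → S <+: L' → Reached (v * D) S → V ∈ received S u := by
    intro S L' hL' hS hr
    refine received_mono (upTo_prefix_of_reached ?_ ?_) u hk1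
    · exact (hΛ.1 k _ (hW k) _ hL').of_prefix List.prefix_rfl hS
    · obtain ⟨b, hb, h⟩ := hr
      exact ⟨b, hb, le_trans (Nat.mul_le_mul_right D huv) h⟩
  rcases hk2 with rfl | ⟨m, hm, hr⟩
  · exact key Q L hL hQL hQ.1
  · obtain ⟨L', hL', rfl⟩ := hΛ.2 i L hL k m (hm.mono hQL)
    exact ⟨k, _, hm, .inl (key L' L' hL' List.prefix_rfl hr)⟩

/-- Proposals extend what has been decided before. -/
theorem Coherent.prefix_of_mem_proposals (hΛ : Coherent D Λ) {W : Fin (2 * f + 1) → Chain f X}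
    (hW : ∀ i, W i ∈ Λ i) {u v : ℕ} (huv : u ≤ v) {V V' : Ledger X} (hV : V ∈ decided D W u)
    {L : Chain f X} (hL : L ∈ Λ (leader f v)) (hV' : V' ∈ proposals D (leader f v) L v) :
    V <+: V' := by
  induction v using Nat.strong_induction_on generalizing L V' with
  | _ v ih =>
    rcases huv.eq_or_lt with rfl | huv
    · obtain ⟨k, hk, -⟩ := exists_mem_of_majorities hV hV
      obtain ⟨L', hL', h⟩ := hΛ.exists_origin (hW k) (received_mono (upTo_prefix _ _) u hk)
      rw [proposals_eq (hΛ.1 _ _ hL' _ hL) h hV']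
    · obtain ⟨_, Q, hQ, hr, -, rfl⟩ := hV'
      -- The proposal being extended is from a view `w ≥ u`, since `V` itself has been received.
      obtain ⟨w, huw, hwv, hw⟩ :=
        exists_latest_mem ⟨V, hΛ.mem_received hW huv hV hL hQ hr⟩ huv
      obtain ⟨L', hL', h⟩ := hΛ.exists_origin hL (received_mono hQ w hw)
      exact (ih w hwv huw hL' h).trans (List.prefix_append _ _)

theorem Coherent.exists_proposal_of_decided (hΛ : Coherent D Λ)
    {W : Fin (2 * f + 1) → Chain f X} (hW : ∀ i, W i ∈ Λ i) {v : ℕ} {V : Ledger X}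
    (hV : V ∈ decided D W v) : ∃ L ∈ Λ (leader f v), V ∈ proposals D (leader f v) L v := by
  obtain ⟨k, hk, -⟩ := exists_mem_of_majorities hV hV
  exact hΛ.exists_origin (hW k) (received_mono (upTo_prefix _ _) v hk)

theorem Coherent.decided_prefix (hΛ : Coherent D Λ) {W W' : Fin (2 * f + 1) → Chain f X}
    (hW : ∀ i, W i ∈ Λ i) (hW' : ∀ i, W' i ∈ Λ i) {u v : ℕ} (huv : u ≤ v) {V V' : Ledger X}
    (hV : V ∈ decided D W u) (hV' : V' ∈ decided D W' v) : V <+: V' :=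
  let ⟨_, hL, h⟩ := hΛ.exists_proposal_of_decided hW' hV'
  hΛ.prefix_of_mem_proposals hW huv hV hL h

theorem Coherent.consistent_latest (hΛ : Coherent D Λ) {W W' : Fin (2 * f + 1) → Chain f X}
    (hW : ∀ i, W i ∈ Λ i) (hW' : ∀ i, W' i ∈ Λ i) (t t' : ℕ) :
    Consistent (latest (decided D W) t) (latest (decided D W') t') := by
  rcases latest_spec (decided D W) t with ⟨h, _⟩ | ⟨u, -, h, -⟩
  · rw [h]; exact .inl List.nil_prefix
  rcases latest_spec (decided D W') t' with ⟨h', _⟩ | ⟨v, -, h', -⟩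
  · rw [h']; exact .inr List.nil_prefix
  rcases le_total u v with huv | huv
  · exact .inl (hΛ.decided_prefix hW hW' huv h h')
  · exact .inr (hΛ.decided_prefix hW' hW huv h' h)

theorem Coherent.prefix_latest (hΛ : Coherent D Λ) {W W' : Fin (2 * f + 1) → Chain f X}
    (hW : ∀ i, W i ∈ Λ i) (hW' : ∀ i, W' i ∈ Λ i) {u t : ℕ} (hut : u < t) {V : Ledger X}
    (hV : V ∈ decided D W u) (hV' : V ∈ decided D W' u) : V <+: latest (decided D W') t :=
  let ⟨_, huv, _, h⟩ := exists_latest_mem ⟨V, hV'⟩ hut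
  hΛ.decided_prefix hW hW' huv hV h

theorem Coherent.latest_mono (hΛ : Coherent D Λ) {W W' : Fin (2 * f + 1) → Chain f X}
    (hW : ∀ i, W i ∈ Λ i) (hW' : ∀ i, W' i ∈ Λ i) (h : ∀ i, W i <+: W' i) {t t' : ℕ}
    (ht : t ≤ t') : latest (decided D W) t <+: latest (decided D W') t' := by
  rcases latest_spec (decided D W) t with ⟨h', _⟩ | ⟨u, hu, h', -⟩
  · rw [h']; exact List.nil_prefix
  · exact hΛ.prefix_latest hW hW' (hu.trans_le ht) h' (decided_mono h u h')

/-! ### The overlay ledger: evaluation and time stamps -/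

theorem read_of_coherent (hΛ : Coherent D Λ) {W : Fin (2 * f + 1) → Chain f X}
    (hW : ∀ i, W i ∈ Λ i) (t : ℕ) :
    (consensus f D X).read t W = latest (decided D W) (t / D + 1) :=
  if_pos ⟨Λ, hΛ, hW⟩

theorem read_of_not_plausible {W : Fin (2 * f + 1) → Chain f X} (hW : ¬ Plausible D W) (t : ℕ) :
    (consensus f D X).read t W =
      [⟨t, (List.finRange (2 * f + 1)).flatMap fun i => userTxs (W i)⟩] :=
  if_neg hW

/-- No safety of the chains is needed: plausible ledgers give blocks stamped with starts of
increasing views, and implausible ones a single block. -/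
theorem read_sorted (hD : 0 < D) (W : Fin (2 * f + 1) → Chain f X) (t : ℕ) :
    (∀ b ∈ (consensus f D X).read t W, b.time ≤ t) ∧
      ((consensus f D X).read t W).Pairwise fun b b' => b.time + 1 ≤ b'.time := by
  by_cases h : Plausible D W
  · obtain ⟨Λ, hΛ, hW⟩ := h
    rw [read_of_coherent hΛ hW]
    rcases latest_spec (decided D W) (t / D + 1) with ⟨h, _⟩ | ⟨u, hu, h, _⟩
    · simp [h]
    · obtain ⟨L, hL, hV⟩ := hΛ.exists_proposal_of_decided hW h
      obtain ⟨h1, h2⟩ := hΛ.sorted hD hL hV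
      have : u * D ≤ t := (Nat.mul_le_mul_right D (Nat.le_of_lt_succ hu)).trans
        (Nat.div_mul_le_self t D)
      exact ⟨fun b hb => (h1 b hb).trans this, h2⟩
  · rw [read_of_not_plausible h]
    simp

end Consensus

/-! ### Liveness -/

section Liveness

variable {f : ℕ} {X : Type}

/-- Some of `f + 1` chains leads one of `f + 1` successive views. -/
theorem exists_leader_mem {A : Set (Fin (2 * f + 1))} (hA : f + 1 ≤ A.ncard) (v₀ : ℕ) :
    ∃ v, v₀ ≤ v ∧ v ≤ v₀ + f ∧ leader f v ∈ A := by
  -- Fewer than `2 * f + 1` successive views have distinct leaders, so `f + 1` of them form a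
  -- majority.
  have hinj : Set.InjOn (fun k => leader f (v₀ + k)) (Set.Iio (f + 1)) := by
    intro k hk k' hk' h
    simp only [Set.mem_Iio] at hk hk'
    have h : (v₀ + k) % (2 * f + 1) = (v₀ + k') % (2 * f + 1) := congrArg Fin.val h
    have h' : k ≡ k' [MOD 2 * f + 1] := Nat.ModEq.add_left_cancel' v₀ h
    exact h'.eq_of_lt_of_lt (by omega) (by omega)
  obtain ⟨i, hi, k, hk, rfl⟩ := exists_mem_of_majorities hA
    (B := (fun k => leader f (v₀ + k)) '' Set.Iio (f + 1)) (by
      rw [hinj.ncard_image, Set.ncard_eq_toFinset_card']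
      simp)
  simp only [Set.mem_Iio] at hk
  exact ⟨v₀ + k, by omega, by omega, hi⟩

variable {Client : Type} {ledgers : Fin (2 * f + 1) → Client → ℕ → Chain f X} {gst h τ D : ℕ}
  {A : Set (Fin (2 * f + 1))} {p : Fin (2 * f + 1) → Client}

/-- The chains in a majority `A` are live, and each `i` of them has an honest validator `p i`, whose
messages arrive within `h`. -/
structure LiveMajority (ledgers : Fin (2 * f + 1) → Client → ℕ → Chain f X) (gst h τ D : ℕ)
    (A : Set (Fin (2 * f + 1))) (p : Fin (2 * f + 1) → Client) : Prop where
  card : f + 1 ≤ A.ncard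
  arrive : ∀ i ∈ A, ∀ j, i ≠ j → ∀ s s', gst ≤ s → s + h ≤ s' → ∀ c,
    Contains (ledgers i c s') (Item.packet j (message D j (ledgers j (p i) s)))
  reached : ∀ i ∈ A, ∀ c a s, gst ≤ a → a + τ ≤ s → Reached a (ledgers i c s)
  time_le : ∀ i ∈ A, ∀ c s, ∀ b ∈ ledgers i c s, b.time ≤ s

namespace LiveMajority

variable {c : Client} {t : ℕ} {Λ : Fin (2 * f + 1) → Set (Chain f X)}

/-- A chain does not relay its own messages, so evidence about it has to come through a second live
chain; this is where `1 ≤ f` enters. -/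
theorem exists_ne (hl : LiveMajority ledgers gst h τ D A p) (hf : 1 ≤ f) (i : Fin (2 * f + 1)) :
    ∃ j ∈ A, j ≠ i :=
  Set.exists_ne_of_one_lt_ncard (by have := hl.card; omega) i

/-- The ledgers that honest validators saw are among those that a client can check. -/
theorem mem_of_coherent (hl : LiveMajority ledgers gst h τ D A p) (hΛ : Coherent D Λ)
    (hW : ∀ i, ledgers i c t ∈ Λ i) {i j : Fin (2 * f + 1)} (hi : i ∈ A) (hij : i ≠ j) {s : ℕ}
    (hs : gst ≤ s) (hst : s + h ≤ t) : ledgers j (p i) s ∈ Λ j := by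
  obtain ⟨L, hL, he⟩ := hΛ.2 i _ (hW i) j _ (hl.arrive i hi j hij s t hs hst c)
  injection he with he
  exact he ▸ hL

/-- What every client has received before the end of a view is accepted. -/
theorem accepted (hl : LiveMajority ledgers gst h τ D A p) (hf : 1 ≤ f) (hτ : τ ≤ h)
    (hΛ : Coherent D Λ) (hW : ∀ i, ledgers i c t ∈ Λ i) {i : Fin (2 * f + 1)} (hi : i ∈ A)
    {s v : ℕ} (hs : gst ≤ s) (hsv : s < (v + 1) * D) (hst : s + h + 1 ≤ t) {V : Ledger X}
    (hV : ∀ c', V ∈ received (ledgers i c' s) v) :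
    V ∈ received (upTo ((v + 1) * D) (ledgers i c t)) v := by
  obtain ⟨j, hj, hji⟩ := hl.exists_ne hf i
  have hS := hl.mem_of_coherent hΛ hW hj hji hs (by omega)
  have htime := hl.time_le i hi (p j) s
  refine received_mono ?_ v (hV (p j))
  rcases hΛ.1 i _ hS _ (hW i) with hp | hp
  · have := upTo_mono ((v + 1) * D) hp
    rwa [upTo_eq_self fun b hb => (htime b hb).trans_lt hsv] at this
  -- The client's ledger has a block of time at least `s + 1`, hence is no prefix of one output at
  -- time `s`; the `+ 1` in `hst` serves this.
  · obtain ⟨b, hb, hsb⟩ := hl.reached i hi c (s + 1) t (by omega) (by omega)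
    have := htime b (hp.subset hb)
    omega

/-- A view whose leader is live decides a block with all transactions input before the view. -/
theorem exists_decided (hl : LiveMajority ledgers gst h τ D A p) (hf : 1 ≤ f) (hτ : τ ≤ h)
    (hD : τ + 3 * h < D) (hΛ : Coherent D Λ) (hW : ∀ i, ledgers i c t ∈ Λ i) {v : ℕ}
    (hv : leader f v ∈ A) (hgst : gst ≤ v * D) (ht : (v + 1) * D + h ≤ t) :
    ∃ V ∈ decided D (fun i => ledgers i c t) v, ∃ b ∈ V, b.time = v * D ∧
      ∀ x s, gst ≤ s → s < v * D →
        (∀ c', Contains (ledgers (leader f v) c' s) (Item.user x)) → x ∈ b.txs := by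
  have hv1 : (v + 1) * D = v * D + D := Nat.succ_mul v D
  -- All live chains enter the view by `v * D + τ`, and `h` later the leader's ledger contains their
  -- snapshots.
  have hready : ∀ c', Ready D (leader f v) v (ledgers (leader f v) c' (v * D + τ + h)) := by
    refine fun c' => ⟨hl.reached _ hv _ _ _ hgst (by omega), hl.card.trans <|
      Set.ncard_le_ncard (fun k hk => ?_) (Set.toFinite _)⟩
    by_cases hkl : k = leader f v
    · exact .inl hkl
    · exact .inr ⟨_, hl.arrive _ hv k (Ne.symm hkl) (v * D + τ) _ (by omega) le_rfl c',
        hl.reached k hk _ _ _ hgst le_rfl⟩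
  have hmem : ∀ i ∈ A, i ≠ leader f v → ∀ s, gst ≤ s → s ≤ v * D + τ + h →
      ledgers (leader f v) (p i) s ∈ Λ (leader f v) := fun i hi hne s hs hs' =>
    hl.mem_of_coherent hΛ hW hi hne hs (by omega)
  obtain ⟨i₀, hi₀, hne₀⟩ := hl.exists_ne hf (leader f v)
  obtain ⟨V, hV⟩ := exists_proposal (hready (p i₀))
  have hother : ∀ i ∈ A, i ≠ leader f v → ∀ c',
      V ∈ received (ledgers i c' (v * D + τ + h + h)) v := by
    intro i hi hne c'
    obtain ⟨V', hV'⟩ := exists_proposal (hready (p i))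
    -- The validators `p i₀` and `p i` may see different ledgers of the leader, but coherence makes
    -- the proposals equal.
    obtain rfl := proposals_eq (hΛ.1 _ _ (hmem i₀ hi₀ hne₀ _ (by omega) le_rfl) _
      (hmem i hi hne _ (by omega) le_rfl)) hV hV'
    exact ⟨_, _, hl.arrive i hi _ hne _ _ (by omega) le_rfl c', .inr hV'⟩
  -- The leader accepts its own proposal only when it returns from another chain. This third delay
  -- `h` explains `τ + 3 * h < D`.
  have hleader : ∀ c', V ∈ received (ledgers (leader f v) c' (v * D + τ + h + h + h)) v :=
    fun c' => ⟨_, _, hl.arrive _ hv i₀ hne₀.symm _ _ (by omega) le_rfl c',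
      .inl (hother i₀ hi₀ hne₀ _)⟩
  refine ⟨V, hl.card.trans (Set.ncard_le_ncard (fun i hi => ?_) (Set.toFinite _)), ?_⟩
  · by_cases hil : i = leader f v
    · rw [← hil] at hleader
      exact hl.accepted hf hτ hΛ hW hi (by omega) (by omega) (by omega) hleader
    · exact hl.accepted hf hτ hΛ hW hi (by omega) (by omega) (by omega) (hother i hi hil)
  · obtain ⟨_, Q, hQ, hr, -, rfl⟩ := hV
    refine ⟨⟨v * D, userTxs Q⟩, by simp [extension], rfl, fun x s hs hsv hx => ?_⟩
    refine mem_userTxs.2 ((hx (p i₀)).mono ?_)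
    -- The proposing prefix `Q` has reached `v * D`, while the ledger at time `s < v * D` has not,
    -- so it is a prefix of `Q`.
    rcases (hΛ.1 _ _ (hmem i₀ hi₀ hne₀ s hs (by omega)) _
      (hmem i₀ hi₀ hne₀ _ (by omega) le_rfl)).of_prefix List.prefix_rfl hQ with hp | hp
    · exact hp
    · obtain ⟨b, hb, hvb⟩ := hr.1
      have := hl.time_le _ hv _ _ b (hp.subset hb)
      omega

/-- The overlay ledger has a recent block with all transactions that are not too recent. -/
theorem exists_block (hl : LiveMajority ledgers gst h τ D A p) (hf : 1 ≤ f) (hτ : τ ≤ h)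
    (hD : τ + 3 * h < D) {s : ℕ} (hs : gst ≤ s) (ht : s + ((f + 2) * D + h) ≤ t) :
    ∃ b ∈ (consensus f D X).read t fun i => ledgers i c t, s ≤ b.time ∧
      ∀ x, (∀ i ∈ A, ∀ c', ∀ s' ≥ s, Contains (ledgers i c' s') (Item.user x)) → x ∈ b.txs := by
  by_cases hp : Plausible D fun i => ledgers i c t
  · obtain ⟨Λ, hΛ, hW⟩ := hp
    have hD0 : 0 < D := by omega
    -- View `s / D + 1` is the first to start after `s`; a live leader comes within `f + 1` views,
    -- so its view ends by `s + (f + 2) * D`.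
    obtain ⟨v, hv₀, hvf, hv⟩ := exists_leader_mem hl.card (s / D + 1)
    have hsv : s < v * D := (Nat.div_lt_iff_lt_mul hD0).1 (by omega)
    have hvt : (v + 1) * D ≤ s + (f + 2) * D := by
      calc (v + 1) * D ≤ (s / D + (f + 2)) * D := Nat.mul_le_mul_right D (by omega)
        _ = s / D * D + (f + 2) * D := Nat.add_mul _ _ _
        _ ≤ s + (f + 2) * D := Nat.add_le_add_right (Nat.div_mul_le_self s D) _
    obtain ⟨V, hV, b, hb, hbt, hx⟩ :=
      hl.exists_decided hf hτ hD hΛ hW hv (by omega) (by omega)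
    have hvD : v < t / D + 1 := Nat.lt_succ_of_le <| (Nat.le_div_iff_mul_le hD0).2 <|
      by
        have := Nat.mul_le_mul_right D (Nat.le_succ v)
        rw [Nat.succ_eq_add_one] at this
        omega
    rw [read_of_coherent hΛ hW]
    exact ⟨b, (hΛ.prefix_latest hW hW hvD hV hV).subset hb, by omega,
      fun x hx' => hx x s hs hsv fun c' => hx' _ hv c' s le_rfl⟩
  · rw [read_of_not_plausible hp]
    refine ⟨_, List.mem_singleton_self _, by simp only; omega, fun x hx => ?_⟩
    obtain ⟨i, hi, -⟩ := hl.exists_ne hf 0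
    exact List.mem_flatMap.2
      ⟨i, List.mem_finRange i, mem_userTxs.2 (hx i hi c t (by omega))⟩

end LiveMajority

end Liveness

/-! ### The overlay protocol as a blockchain protocol -/

section Protocol

variable {f D Δ : ℕ} {X Client : Type}
  {P : Fin (2 * f + 1) → Protocol Client (Item (2 * f + 1) X (consensus f D X).Pkt)}

/-- The coherent family consists of all ledgers that clients ever output. -/
theorem consensus_safe (hP : ∀ i, (P i).Safe) : ((consensus f D X).on Δ P).Safe := by
  rintro _ ⟨r, rfl⟩
  have hs := fun i => hP i _ (r.exec_mem i)
  have hΛ : Coherent (f := f) (X := X) D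
      fun i => {L | ∃ c t, (P i).ledger (r.exec i) c t = L} := by
    refine ⟨?_, ?_⟩
    · rintro i _ ⟨c, t, rfl⟩ _ ⟨c', t', rfl⟩
      exact (hs i).1 c c' t t'
    · rintro i _ ⟨c, t, rfl⟩ j m hm
      obtain ⟨c', t', -, hm⟩ := r.authentic i j m c t hm
      exact ⟨_, ⟨c', t', rfl⟩, List.mem_singleton.1 hm⟩
  have hW : ∀ c t i, (P i).ledger (r.exec i) c t ∈
      {L | ∃ c t, (P i).ledger (r.exec i) c t = L} := fun c t i => ⟨c, t, rfl⟩
  have hread : ∀ c t, ((consensus f D X).on Δ P).ledger r.toExecution c t =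
      latest (decided D fun i => (P i).ledger (r.exec i) c t) (t / D + 1) :=
    fun c t => read_of_coherent hΛ (hW c t) t
  refine ⟨fun c c' t t' => ?_, fun c t t' htt' => ?_⟩
  · rw [hread, hread]
    exact hΛ.consistent_latest (hW c t) (hW c' t') _ _
  · rw [hread, hread]
    exact hΛ.latest_mono (hW c t) (hW c t') (fun i => (hs i).2 c t t' htt')
      (Nat.succ_le_succ (Nat.div_le_div_right htt'))

/-- As for safety, with the family of all ledgers confirmed by sets of broadcast messages. -/
theorem consensus_generatesCertificates (hP : ∀ i, (P i).GeneratesCertificates) :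
    ((consensus f D X).on Δ P).GeneratesCertificates := by
  rintro _ - ⟨r, rfl, hr⟩
  have hs := fun i => hP i _ (r.exec_mem i) (hr i)
  have hΛ : Coherent (f := f) (X := X) D
      fun i => {L | ∃ t M, M ⊆ (r.exec i).bcast t ∧ (P i).confirm t M = L} := by
    refine ⟨?_, ?_⟩
    · rintro i _ ⟨t, M, hM, rfl⟩ _ ⟨t', M', hM', rfl⟩
      exact hs i t t' M M' hM hM' _ _ List.prefix_rfl List.prefix_rfl
    · rintro i _ ⟨t, M, hM, rfl⟩ j m hm
      obtain ⟨t', M', -, hM', hm⟩ := r.authentic_certified i j m t M hM hm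
      exact ⟨_, ⟨t', M', hM', rfl⟩, List.mem_singleton.1 hm⟩
  intro t₁ t₂ M₁ M₂ h₁ h₂ L₁ L₂ hL₁ hL₂
  have hW : ∀ t M, M ⊆ r.toExecution.bcast t → ∀ i,
      (P i).confirm t {m | (⟨i, m⟩ : Σ i, (P i).Msg) ∈ M} ∈
        {L | ∃ t M, M ⊆ (r.exec i).bcast t ∧ (P i).confirm t M = L} :=
    fun t M hM i => ⟨t, _, fun m hm => hM hm, rfl⟩
  have e₁ := read_of_coherent hΛ (hW t₁ M₁ h₁) t₁
  have e₂ := read_of_coherent hΛ (hW t₂ M₂ h₂) t₂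
  have := hΛ.consistent_latest (hW t₁ M₁ h₁) (hW t₂ M₂ h₂) (t₁ / D + 1) (t₂ / D + 1)
  rw [← e₁, ← e₂] at this
  exact this.of_prefix hL₁ hL₂

theorem consensus_proceedsInEpochs (hD : 0 < D) :
    ((consensus f D X).on Δ P).ProceedsInEpochs 1 := by
  rintro _ ⟨r, rfl⟩ -
  exact fun c t => read_sorted hD _ t

/-- The delay `Δ + τ` is the time for relaying a packet plus the time for its inclusion by a live
chain. -/
theorem liveMajority_of_run {τ : ℕ} (hP : ∀ i, ∃ T₀, 0 < T₀ ∧ (P i).ProceedsInEpochs T₀)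
    (hA : f + 1 ≤ {i | (P i).Live τ}.ncard) (r : (consensus f D X).Run Δ P) :
    ∃ p, LiveMajority (f := f) (X := X) (fun i c t => (P i).ledger (r.exec i) c t) r.gst
      (Δ + τ) τ D {i | (P i).Live τ} p := by
  have hl : ∀ i ∈ {i | (P i).Live τ}, (P i).LiveIn (r.exec i) τ := fun i hi => hi _ (r.exec_mem i)
  have hc : Nonempty Client := by
    obtain ⟨i, hi, -⟩ := exists_mem_of_majorities hA hA
    exact (r.honest_nonempty i ⟨τ, hl i hi⟩).to_type
  have hp : ∀ i, ∃ q, i ∈ {i | (P i).Live τ} → q ∈ r.honest i := fun i => by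
    by_cases hi : i ∈ {i | (P i).Live τ}
    · exact (r.honest_nonempty i ⟨τ, hl i hi⟩).imp fun q hq _ => hq
    · exact hc.elim fun q => ⟨q, fun h => absurd h hi⟩
  choose p hp using hp
  refine ⟨p, hA, ?_, ?_, ?_⟩
  · intro i hi j hij s s' hs hs' c
    obtain ⟨s₁, h₁, h₂, hin⟩ := r.relay i j hij (p i) (hp i hi) s _ (List.mem_singleton_self _)
    refine (hl i hi).1 s₁ _ hin c s' ?_
    rw [r.gst_eq]
    omega
  · intro i hi c a s ha has
    obtain ⟨b, hb, h⟩ := (hl i hi).2 c s (by rw [r.gst_eq]; omega)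
    exact ⟨b, hb, by omega⟩
  · intro i hi c s
    obtain ⟨T₀, -, hT⟩ := hP i
    exact (hT _ (r.exec_mem i) ⟨τ, hl i hi⟩ c s).1

theorem consensus_live {τ : ℕ} (hf : 1 ≤ f) (hD : τ + 3 * (Δ + τ) < D)
    (hP : ∀ i, ∃ T₀, 0 < T₀ ∧ (P i).ProceedsInEpochs T₀)
    (hA : f + 1 ≤ {i | (P i).Live τ}.ncard) :
    ((consensus f D X).on Δ P).Live (τ + ((f + 2) * D + (Δ + τ))) := by
  rintro _ ⟨r, rfl⟩
  obtain ⟨p, hl⟩ := liveMajority_of_run hP hA r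
  refine ⟨fun t x hx c t' ht' => ?_, fun c t' ht' => ?_⟩
  · change max r.gst t + _ ≤ t' at ht'
    obtain ⟨b, hb, -, h⟩ := hl.exists_block (c := c) (t := t') hf (Nat.le_add_left τ Δ) hD
      -- From this time on, `x` is in every client's ledger of every live chain.
      (s := max r.gst t + τ) (by omega) (by omega)
    refine ⟨b, hb, h x fun i hi c' s' hs' => ?_⟩
    refine (hi _ (r.exec_mem i)).1 t _ (hx i) c' s' ?_
    rw [r.gst_eq]
    exact hs'
  · change r.gst + _ ≤ t' at ht'
    obtain ⟨b, hb, h, -⟩ := hl.exists_block (c := c) (t := t') hf (Nat.le_add_left τ Δ) hD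
      (s := t' - ((f + 2) * D + (Δ + τ))) (by omega) (by omega)
    exact ⟨b, hb, by omega⟩

end Protocol

end Interchain

theorem mainTheorem11 (f : ℕ) (hf : 1 ≤ f) (X : Type) (Δ τ : ℕ) :
    ∃ (C : Overlay (2 * f + 1) X) (T τ' : ℕ), 0 < T ∧
      ∀ (Client : Type) (P : Fin (2 * f + 1) → Protocol Client (Item (2 * f + 1) X C.Pkt)),
        (∀ i, ∃ T₀, 0 < T₀ ∧ (P i).ProceedsInEpochs T₀) →
          ((∀ i, (P i).Safe) → (C.on Δ P).Safe) ∧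
          (f + 1 ≤ {i | (P i).Live τ}.ncard → (C.on Δ P).Live τ') ∧
          ((∀ i, (P i).GeneratesCertificates) → (C.on Δ P).GeneratesCertificates) ∧
          (C.on Δ P).ProceedsInEpochs T := by
  -- The least view length allowed by `consensus_live`.
  have hD : τ + 3 * (Δ + τ) < τ + 3 * (Δ + τ) + 1 := Nat.lt_succ_self _
  exact ⟨consensus f (τ + 3 * (Δ + τ) + 1) X, 1, _, Nat.one_pos, fun _ _ hP =>
    ⟨consensus_safe, consensus_live hf hD hP, consensus_generatesCertificates,
      consensus_proceedsInEpochs (Nat.succ_pos _)⟩⟩
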